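/- Let $p$ be a prime and let $\mathbb{F}$ be a field of characteristic $p$. Let $L$ and $H$ be restricted Lie algebras over $\mathbb{F}$, with $p$-maps written $x\mapsto x^{[p]}$, and let $u(L)$ and $u(H)$ be their restricted enveloping algebras, where $u(L)$ is the quotient of the universal enveloping algebra of $L$ by the two-sided ideal generated by the elements $x^p-x^{[p]}$, $x\in L$. Suppose that $L$ is finite-dimensional and $p$-nilpotent (every $x\in L$ is sent to $0$ by some iterate of the $p$-map) and that $u(L)\cong u(H)$ as associative $\mathbb{F}$-algebras. Then $L$ and $H$ are nilpotent Lie algebras and their nilpotency classes satisfy $$|\mathrm{cl}(L)-\mathrm{cl}(H)|\le 1.$$ Here $\gamma_1(L)=L$, $\gamma_{i+1}(L)=[\gamma_i(L),L]$, and the nilpotency class $\mathrm{cl}(L)$ of a nilpotent Lie algebra $L$ is the least integer $c\ge 0$ with $\gamma_{c+1}(L)=0$. -/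

import Mathlib

open Polynomial in
/-- The elements `s_i(x, y)` of a Lie algebra in the axiom for the `p`-map of a sum:
`i • s_i(x, y)` is the coefficient of `λ ^ (i - 1)` in `(ad (λ x + y)) ^ (p - 1) (x)`,
where `λ` is a central indeterminate. It is used for `1 ≤ i ≤ p - 1` only, where `i` is
invertible in a field of characteristic `p`. -/
noncomputable def jacobsonS (F : Type*) [Field F] (p : ℕ) {L : Type*} [LieRing L] [LieAlgebra F L]
    (i : ℕ) (x y : L) : L :=
  (i : F)⁻¹ •
    (((C (LieAlgebra.ad F L x) * X + C (LieAlgebra.ad F L y) : (Module.End F L)[X]) ^ (p - 1)).coeff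
      (i - 1)) x

/-- A restricted Lie algebra over a field `F` of characteristic `p`: a Lie algebra over `F` with a
`p`-map `x ↦ x^[p]` that satisfies Jacobson's three axioms. -/
class RestrictedLieAlgebra (F : Type*) [Field F] (p : ℕ) (L : Type*) [LieRing L]
    [LieAlgebra F L] where
  /-- The `p`-map `x ↦ x^[p]`. -/
  pMap : L → L
  pMap_smul : ∀ (a : F) (x : L), pMap (a • x) = a ^ p • pMap x
  ad_pMap : ∀ x : L, LieAlgebra.ad F L (pMap x) = LieAlgebra.ad F L x ^ p
  pMap_add : ∀ x y : L,
    pMap (x + y) = pMap x + pMap y + ∑ i ∈ Finset.Icc 1 (p - 1), jacobsonS F p i x y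

namespace RestrictedLieAlgebra

/-- Every element of `L` is killed by some iterate of the `p`-map. (For a finite-dimensional `L` one
iterate then kills all elements; that is not assumed here.) -/
def IsPNilpotent (F : Type*) [Field F] (p : ℕ) (L : Type*) [LieRing L] [LieAlgebra F L]
    [RestrictedLieAlgebra F p L] : Prop :=
  ∀ x : L, ∃ n : ℕ, (pMap F p)^[n] x = 0

/-- The relations `x ^ p = x^[p]`, for `x` in `L`, in the universal enveloping algebra of `L`. -/
inductive EnvelopingRel (F : Type*) [Field F] (p : ℕ) (L : Type*) [LieRing L] [LieAlgebra F L]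
    [RestrictedLieAlgebra F p L] :
    UniversalEnvelopingAlgebra F L → UniversalEnvelopingAlgebra F L → Prop
  | pow_eq (x : L) : EnvelopingRel F p L (UniversalEnvelopingAlgebra.ι F x ^ p)
      (UniversalEnvelopingAlgebra.ι F (pMap F p x))

/-- The restricted enveloping algebra `u(L)`: the quotient of the universal enveloping algebra of
`L` by the two-sided ideal generated by all `x ^ p - x^[p]`, `x ∈ L`. -/
abbrev Enveloping (F : Type*) [Field F] (p : ℕ) (L : Type*) [LieRing L] [LieAlgebra F L]
    [RestrictedLieAlgebra F p L] :=
  RingQuot (EnvelopingRel F p L)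

end RestrictedLieAlgebra

namespace RestrictedLieAlgebra

attribute [local instance 100] LieRing.ofAssociativeRing

open LieModule (lowerCentralSeries)

/-! ### Universal property and adjoint action of `u(L)` -/

section Enveloping

variable (F : Type*) [Field F] (p : ℕ) (L : Type*) [LieRing L] [LieAlgebra F L]
  [RestrictedLieAlgebra F p L]

/-! Let `I` be the augmentation ideal. By Engel's theorem `I(L)` is nilpotent, so any algebra
isomorphism `u(L) ≅ u(H)` preserves augmentations and carries powers of `I(L)` to powers of `I(H)`.

Mathlib's term `n` of the lower central series is `γ_{n+1}`; it lies in `I^(n+1)`. The isomorphism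
matches these terms modulo `I^(n+2)` (`exists_map_sub_toEnveloping_mem`). If `γ_{n+1}(L) = 0`, then
`γ_{n+1}(H)` falls one power deeper, into `I(H)^(n+2)`. The adjoint action sends `I(H)^k × H` into
`γ_{k+1}(H)`, so `γ_{n+2}(H) ⊆ γ_{n+3}(H)`, and nilpotency forces `γ_{n+2}(H) = 0`. Symmetry gives
the other bound.

Injectivity of `L → u(L)` is never needed: everything returns to `L` through `ad`, at the cost of
one step in the series. -/

/-- The canonical map of a restricted Lie algebra to its restricted enveloping algebra. -/
noncomputable def toEnveloping : L →ₗ⁅F⁆ Enveloping F p L :=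
  (RingQuot.mkAlgHom F (EnvelopingRel F p L)).toLieHom.comp (UniversalEnvelopingAlgebra.ι F)

variable {L} in
theorem toEnveloping_lie (x y : L) : toEnveloping F p L ⁅x, y⁆ =
    toEnveloping F p L x * toEnveloping F p L y -
      toEnveloping F p L y * toEnveloping F p L x := by
  rw [LieHom.map_lie, LieRing.of_associative_ring_bracket]

variable {L} in
theorem toEnveloping_pMap (x : L) :
    toEnveloping F p L (pMap F p x) = toEnveloping F p L x ^ p := by
  have h := RingQuot.mkAlgHom_rel F (EnvelopingRel.pow_eq (F := F) (p := p) x)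
  rw [map_pow] at h
  exact h.symm

variable {L} in
theorem toEnveloping_iterate_pMap (n : ℕ) (x : L) :
    toEnveloping F p L ((pMap F p)^[n] x) = toEnveloping F p L x ^ p ^ n := by
  induction n with
  | zero => simp
  | succ n ih => rw [Function.iterate_succ_apply', toEnveloping_pMap, ih, ← pow_mul, ← pow_succ]

variable {F p L}

/-- A Lie homomorphism to an associative algebra that takes the `p`-map to the `p`-th power
extends to the restricted enveloping algebra. -/
noncomputable def Enveloping.lift {B : Type*} [Ring B] [Algebra F B] (f : L →ₗ⁅F⁆ B)
    (hf : ∀ x, f (pMap F p x) = f x ^ p) : Enveloping F p L →ₐ[F] B :=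
  RingQuot.liftAlgHom F ⟨UniversalEnvelopingAlgebra.lift F f, by
    rintro _ _ ⟨x⟩
    rw [map_pow, UniversalEnvelopingAlgebra.lift_ι_apply, UniversalEnvelopingAlgebra.lift_ι_apply,
      hf]⟩

@[simp]
theorem Enveloping.lift_toEnveloping {B : Type*} [Ring B] [Algebra F B] (f : L →ₗ⁅F⁆ B)
    (hf : ∀ x, f (pMap F p x) = f x ^ p) (x : L) :
    Enveloping.lift f hf (toEnveloping F p L x) = f x := by
  rw [Enveloping.lift]
  change RingQuot.liftAlgHom F _ (RingQuot.mkAlgHom F _ _) = _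
  rw [RingQuot.liftAlgHom_mkAlgHom_apply]
  exact UniversalEnvelopingAlgebra.lift_ι_apply F f x

/-- The universal property gives a section of the inclusion of the subalgebra cut out by `C`, which
is therefore everything. -/
theorem Enveloping.induction {C : Enveloping F p L → Prop}
    (algebraMap : ∀ r : F, C (algebraMap F _ r)) (of : ∀ x : L, C (toEnveloping F p L x))
    (mul : ∀ a b, C a → C b → C (a * b)) (add : ∀ a b, C a → C b → C (a + b))
    (a : Enveloping F p L) : C a := by
  let S : Subalgebra F (Enveloping F p L) :=
    { carrier := {a | C a}
      mul_mem' := fun ha hb => mul _ _ ha hb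
      add_mem' := fun ha hb => add _ _ ha hb
      algebraMap_mem' := algebraMap }
  let f : L →ₗ⁅F⁆ S :=
    { toFun := fun x => ⟨toEnveloping F p L x, of x⟩
      map_add' := fun x y => Subtype.ext (map_add _ x y)
      map_smul' := fun r x => Subtype.ext (map_smul _ r x)
      map_lie' := fun {x y} => Subtype.ext (toEnveloping_lie F p x y) }
  let φ := Enveloping.lift f fun x => Subtype.ext (toEnveloping_pMap F p x)
  have h : S.val.comp φ = AlgHom.id F _ := by
    refine RingQuot.ringQuot_ext' F _ _ (UniversalEnvelopingAlgebra.hom_ext F (LieHom.ext fun x => ?_))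
    exact congrArg Subtype.val (Enveloping.lift_toEnveloping f _ x)
  have ha : (φ a : Enveloping F p L) = a := DFunLike.congr_fun h a
  exact ha ▸ (φ a).2

variable (F p L)

/-- The adjoint representation of the restricted enveloping algebra. -/
noncomputable def envelopingAd : Enveloping F p L →ₐ[F] Module.End F L :=
  Enveloping.lift (LieAlgebra.ad F L) (ad_pMap (F := F) (p := p))

variable {F p L} in
theorem envelopingAd_toEnveloping (x y : L) :
    envelopingAd F p L (toEnveloping F p L x) y = ⁅x, y⁆ := by
  rw [envelopingAd, Enveloping.lift_toEnveloping, LieAlgebra.ad_apply]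

/-! ### Powers of the augmentation ideal and the lower central series -/

section Augmentation

variable [Fact p.Prime]

/-- The augmentation of the restricted enveloping algebra. -/
noncomputable def augmentation : Enveloping F p L →ₐ[F] F :=
  Enveloping.lift 0 fun _ => by simp [(Fact.out : p.Prime).ne_zero]

variable {L} in
@[simp]
theorem augmentation_toEnveloping (x : L) : augmentation F p L (toEnveloping F p L x) = 0 :=
  Enveloping.lift_toEnveloping _ _ x

/-- The augmentation ideal of the restricted enveloping algebra, as a subspace. -/
noncomputable def augmentationIdeal : Submodule F (Enveloping F p L) :=
  LinearMap.ker (augmentation F p L).toLinearMap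

variable {F p L}

theorem mem_augmentationIdeal {a : Enveloping F p L} :
    a ∈ augmentationIdeal F p L ↔ augmentation F p L a = 0 := Iff.rfl

theorem toEnveloping_mem_augmentationIdeal (x : L) :
    toEnveloping F p L x ∈ augmentationIdeal F p L := augmentation_toEnveloping F p x

theorem sub_augmentation_mem (a : Enveloping F p L) :
    a - algebraMap F _ (augmentation F p L a) ∈ augmentationIdeal F p L := by
  simp [mem_augmentationIdeal]

theorem exists_sub_toEnveloping_mem {a : Enveloping F p L} (ha : a ∈ augmentationIdeal F p L) :
    ∃ x : L, a - toEnveloping F p L x ∈ augmentationIdeal F p L ^ 2 := by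
  suffices h : ∀ a : Enveloping F p L, ∃ x : L,
      a - algebraMap F _ (augmentation F p L a) - toEnveloping F p L x ∈
        augmentationIdeal F p L ^ 2 by
    simpa [mem_augmentationIdeal.1 ha] using h a
  intro a
  induction a using Enveloping.induction with
  | algebraMap r => exact ⟨0, by simp⟩
  | of x => exact ⟨x, by simp⟩
  | add a b ha hb =>
    obtain ⟨x, hx⟩ := ha
    obtain ⟨y, hy⟩ := hb
    refine ⟨x + y, ?_⟩
    convert add_mem hx hy using 1
    simp only [map_add]
    abel
  | mul a b ha hb =>
    obtain ⟨x, hx⟩ := ha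
    obtain ⟨y, hy⟩ := hb
    -- With `ε` the augmentation, `ab - ε(a)ε(b) = (a - ε(a))(b - ε(b)) + ε(b)(a - ε(a)) + ε(a)(b -
    -- ε(b))`.
    refine ⟨augmentation F p L b • x + augmentation F p L a • y, ?_⟩
    have h := Submodule.mul_mem_mul (sub_augmentation_mem a) (sub_augmentation_mem b)
    rw [← pow_two] at h
    convert add_mem h (add_mem (Submodule.smul_mem _ (augmentation F p L b) hx)
      (Submodule.smul_mem _ (augmentation F p L a) hy)) using 1
    simp only [map_add, map_mul, map_smul, Algebra.algebraMap_eq_smul_one, sub_mul, mul_sub,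
      smul_sub, smul_mul_assoc, mul_smul_comm, one_mul, mul_one, smul_smul,
      mul_comm (augmentation F p L b)]
    abel

/-- Powers of the augmentation ideal move any Lie module that is a module of the restricted
enveloping algebra down its lower central series. -/
theorem apply_mem_lowerCentralSeries {M : Type*} [AddCommGroup M] [Module F M] [LieRingModule L M]
    [LieModule F L M] (ρ : Enveloping F p L →ₐ[F] Module.End F M)
    (hρ : ∀ (x : L) (m : M), ρ (toEnveloping F p L x) m = ⁅x, m⁆) (n k : ℕ)
    {a : Enveloping F p L} (ha : a ∈ augmentationIdeal F p L ^ n) {m : M}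
    (hm : m ∈ lowerCentralSeries F L M k) : ρ a m ∈ lowerCentralSeries F L M (n + k) := by
  -- Each `a` acts on successive quotients by the scalar `ε(a)`. This form, unlike the one for `ε(a)
  -- = 0`, is stable under products.
  have step : ∀ a : Enveloping F p L, ∀ k, ∀ m ∈ lowerCentralSeries F L M k,
      ρ a m - augmentation F p L a • m ∈ lowerCentralSeries F L M (k + 1) := by
    intro a
    induction a using Enveloping.induction with
    | algebraMap r => intro k m _; simp [Module.algebraMap_end_apply]
    | of x =>
      intro k m hm
      rw [hρ, augmentation_toEnveloping, zero_smul, sub_zero, LieModule.lowerCentralSeries_succ]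
      exact LieSubmodule.lie_mem_lie (LieSubmodule.mem_top x) hm
    | add a b ha hb =>
      intro k m hm
      convert add_mem (ha k m hm) (hb k m hm) using 1
      simp only [map_add, LinearMap.add_apply, add_smul]
      abel
    | mul a b ha hb =>
      intro k m hm
      have h1 := hb k m hm
      have h2 := LieModule.antitone_lowerCentralSeries F L M (Nat.le_succ _) (ha _ _ h1)
      have h3 := ha k m hm
      convert add_mem h2 (add_mem ((lowerCentralSeries F L M (k + 1)).smul_mem
        (augmentation F p L a) h1) ((lowerCentralSeries F L M (k + 1)).smul_mem
        (augmentation F p L b) h3)) using 1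
      simp only [map_mul, map_sub, map_smul, Module.End.mul_apply, smul_sub, smul_smul,
        mul_comm (augmentation F p L b)]
      abel
  have step' : ∀ a ∈ augmentationIdeal F p L, ∀ k, ∀ m ∈ lowerCentralSeries F L M k,
      ρ a m ∈ lowerCentralSeries F L M (k + 1) := by
    intro a ha k m hm
    simpa [mem_augmentationIdeal.1 ha] using step a k m hm
  induction n generalizing a k m with
  | zero =>
    rw [pow_zero, Submodule.mem_one] at ha
    obtain ⟨r, rfl⟩ := ha
    rw [zero_add, AlgHom.commutes, Module.algebraMap_end_apply]
    exact (lowerCentralSeries F L M k).smul_mem r hm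
  | succ n ih =>
    rw [pow_succ] at ha
    refine Submodule.mul_induction_on ha (fun b hb c hc => ?_) fun b c hb hc => ?_
    · rw [map_mul, Module.End.mul_apply, add_right_comm, add_assoc]
      exact ih (k + 1) hb (step' c hc k m hm)
    · rw [map_add, LinearMap.add_apply]
      exact add_mem hb hc

/-- An element of `L` in the `n`-th power of the augmentation ideal takes `L` to the `n`-th term
of the lower central series. -/
theorem lie_mem_lowerCentralSeries {n : ℕ} {x : L}
    (hx : toEnveloping F p L x ∈ augmentationIdeal F p L ^ n) (y : L) :
    ⁅x, y⁆ ∈ lowerCentralSeries F L L n := by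
  rw [← envelopingAd_toEnveloping (F := F) (p := p)]
  exact apply_mem_lowerCentralSeries (envelopingAd F p L) envelopingAd_toEnveloping n 0 hx (by simp)

/-- Brackets become commutators, so degrees in the filtration by powers add. -/
theorem toEnveloping_mem_augmentationIdeal_pow {n : ℕ} {x : L}
    (hx : x ∈ lowerCentralSeries F L L n) :
    toEnveloping F p L x ∈ augmentationIdeal F p L ^ (n + 1) := by
  induction n generalizing x with
  | zero => simpa using toEnveloping_mem_augmentationIdeal x
  | succ n ih =>
    rw [LieModule.lowerCentralSeries_succ, ← LieSubmodule.mem_toSubmodule,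
      LieSubmodule.lieIdeal_oper_eq_linear_span'] at hx
    refine (Submodule.span_le (p := (augmentationIdeal F p L ^ (n + 1 + 1)).comap
      (toEnveloping F p L).toLinearMap)).2 ?_ hx
    rintro _ ⟨x, -, y, hy, rfl⟩
    change toEnveloping F p L ⁅x, y⁆ ∈ augmentationIdeal F p L ^ (n + 1 + 1)
    rw [toEnveloping_lie]
    refine sub_mem ?_ ?_
    · rw [pow_succ']
      exact Submodule.mul_mem_mul (toEnveloping_mem_augmentationIdeal x) (ih hy)
    · rw [pow_succ]
      exact Submodule.mul_mem_mul (ih hy) (toEnveloping_mem_augmentationIdeal x)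

/-- If the `n`-th term of the lower central series takes `L` to a Lie submodule, then the latter
contains the next term. -/
theorem lowerCentralSeries_succ_le {n : ℕ} {N : LieSubmodule F L L}
    (h : ∀ y ∈ lowerCentralSeries F L L n, ∀ x : L, ⁅y, x⁆ ∈ N) :
    lowerCentralSeries F L L (n + 1) ≤ N := by
  rw [LieModule.lowerCentralSeries_succ, LieSubmodule.lieIdeal_oper_eq_span,
    LieSubmodule.lieSpan_le]
  rintro _ ⟨⟨x, -⟩, ⟨y, hy⟩, rfl⟩
  change ⁅x, y⁆ ∈ N
  rw [← lie_skew]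
  exact neg_mem (h y hy x)

theorem isNilpotent_of_augmentationIdeal_pow_eq_bot {n : ℕ}
    (h : augmentationIdeal F p L ^ n = ⊥) : LieRing.IsNilpotent L := by
  -- Term `n` has zero image in `u(L)`. This only makes it central, through `ad`, hence the extra
  -- step `n + 1`.
  refine LieModule.IsNilpotent.mk (R := F) (k := n + 1) L ?_
  refine eq_bot_iff.2 (lowerCentralSeries_succ_le fun y hy x => ?_)
  have hy' := toEnveloping_mem_augmentationIdeal_pow (p := p) hy
  rw [pow_succ, h, Submodule.bot_mul, Submodule.mem_bot] at hy'
  rw [← envelopingAd_toEnveloping (F := F) (p := p), hy', map_zero, LinearMap.zero_apply]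
  exact zero_mem _

/-- The augmentation ideal is nilpotent if `L` is finite-dimensional and `p`-nilpotent. -/
theorem exists_augmentationIdeal_pow_eq_bot [FiniteDimensional F L] (hnil : IsPNilpotent F p L) :
    ∃ n : ℕ, augmentationIdeal F p L ^ n = ⊥ := by
  let ρ := Algebra.lmul F (Enveloping F p L)
  let f : L →ₗ⁅F⁆ Module.End F (Enveloping F p L) := ρ.toLieHom.comp (toEnveloping F p L)
  let := LieRingModule.compLieHom (Enveloping F p L) f
  have : LieModule F L (Enveloping F p L) := LieModule.compLieHom (Enveloping F p L) f
  have hact (x : L) (a : Enveloping F p L) : ρ (toEnveloping F p L x) a = ⁅x, a⁆ := rfl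
  have : LieModule.IsNilpotent L (Enveloping F p L) := by
    -- Engel's theorem for left multiplication on `u(L)`: only `L` has to be finite-dimensional, not
    -- the module.
    refine LieAlgebra.isEngelian_of_isNoetherian (R := F) _ fun x => ?_
    have hx : LieModule.toEnd F L (Enveloping F p L) x = ρ (toEnveloping F p L x) :=
      LinearMap.ext fun a => (hact x a).symm
    obtain ⟨n, hn⟩ := hnil x
    refine ⟨p ^ n, ?_⟩
    rw [hx, ← map_pow, ← toEnveloping_iterate_pMap, hn, map_zero, map_zero]
  obtain ⟨n, hn⟩ := LieModule.IsNilpotent.nilpotent F L (Enveloping F p L)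
  refine ⟨n, (Submodule.eq_bot_iff _).2 fun a ha => ?_⟩
  have h := apply_mem_lowerCentralSeries ρ hact n 0 ha (m := 1) (by simp)
  rw [add_zero, hn, LieSubmodule.mem_bot] at h
  simpa [ρ] using h

end Augmentation

end Enveloping

/-- `nilpotencyLength` is defined by the series over `ℤ`, whose terms have the same underlying sets.
Nilpotency excludes the junk infimum of an empty set. -/
theorem lowerCentralSeries_eq_bot_iff_nilpotencyLength_le (R L M : Type*) [CommRing R] [LieRing L]
    [LieAlgebra R L] [AddCommGroup M] [Module R M] [LieRingModule L M] [LieModule R L M]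
    [LieModule.IsNilpotent L M] (k : ℕ) :
    lowerCentralSeries R L M k = ⊥ ↔ LieModule.nilpotencyLength L M ≤ k := by
  have aux : ∀ k, lowerCentralSeries R L M k = ⊥ ↔ lowerCentralSeries ℤ L M k = ⊥ := fun k => by
    simp [SetLike.ext'_iff, LieModule.coe_lowerCentralSeries_eq_int R L M]
  rw [aux, LieModule.nilpotencyLength]
  refine ⟨fun h => Nat.sInf_le h, fun h => ?_⟩
  have hs := Nat.sInf_mem (s := {k | lowerCentralSeries ℤ L M k = ⊥})
    (LieModule.IsNilpotent.nilpotent ℤ L M)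
  exact eq_bot_iff.2 ((LieModule.antitone_lowerCentralSeries ℤ L M h).trans_eq hs)

/-! ### Transport along an isomorphism of enveloping algebras -/

section Comparison

variable {F : Type*} [Field F] {p : ℕ} [Fact p.Prime]
  {L : Type*} [LieRing L] [LieAlgebra F L] [RestrictedLieAlgebra F p L]
  {H : Type*} [LieRing H] [LieAlgebra F H] [RestrictedLieAlgebra F p H]

/-- Elements of a nilpotent ideal are nilpotent, and a field has no nonzero nilpotents. -/
theorem augmentation_comp_of_augmentationIdeal_pow_eq_bot
    (e : Enveloping F p L →ₐ[F] Enveloping F p H) {n : ℕ}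
    (h : augmentationIdeal F p L ^ n = ⊥) (a : Enveloping F p L) :
    augmentation F p H (e a) = augmentation F p L a := by
  have h0 : ∀ b ∈ augmentationIdeal F p L, augmentation F p H (e b) = 0 := by
    intro b hb
    have hb' : b ^ n = 0 := by
      rw [← Submodule.mem_bot F, ← h]
      exact Submodule.pow_mem_pow _ hb n
    refine eq_zero_of_pow_eq_zero (n := n) ?_
    rw [← map_pow, ← map_pow, hb', map_zero, map_zero]
  have := h0 _ (sub_augmentation_mem a)
  rwa [map_sub, map_sub, AlgHom.commutes, AlgHom.commutes, sub_eq_zero] at this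

theorem map_augmentationIdeal_pow_le {e : Enveloping F p L →ₐ[F] Enveloping F p H}
    (he : ∀ a, augmentation F p H (e a) = augmentation F p L a) (n : ℕ) {a : Enveloping F p L}
    (ha : a ∈ augmentationIdeal F p L ^ n) : e a ∈ augmentationIdeal F p H ^ n := by
  have h1 : (augmentationIdeal F p L).map e.toLinearMap ≤ augmentationIdeal F p H := by
    rintro _ ⟨b, hb, rfl⟩
    exact (he b).trans hb
  have h2 := Submodule.mem_map_of_mem (f := e.toLinearMap) ha
  rw [Submodule.map_pow] at h2
  exact pow_le_pow_left' h1 n h2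

/-- An algebra homomorphism of restricted enveloping algebras that preserves the augmentation
respects the lower central series modulo powers of the augmentation ideal. -/
theorem exists_map_sub_toEnveloping_mem {e : Enveloping F p L →ₐ[F] Enveloping F p H}
    (he : ∀ a, augmentation F p H (e a) = augmentation F p L a) (n : ℕ) {x : L}
    (hx : x ∈ lowerCentralSeries F L L n) :
    ∃ y ∈ lowerCentralSeries F H H n,
      e (toEnveloping F p L x) - toEnveloping F p H y ∈ augmentationIdeal F p H ^ (n + 2) := by
  have key : ∀ x : L, ∃ y : H,
      e (toEnveloping F p L x) - toEnveloping F p H y ∈ augmentationIdeal F p H ^ 2 := fun x =>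
    exists_sub_toEnveloping_mem <| by
      rw [mem_augmentationIdeal, he, augmentation_toEnveloping]
  induction n generalizing x with
  | zero =>
    obtain ⟨y, hy⟩ := key x
    exact ⟨y, by simp, hy⟩
  | succ n ih =>
    rw [LieModule.lowerCentralSeries_succ, ← LieSubmodule.mem_toSubmodule,
      LieSubmodule.lieIdeal_oper_eq_linear_span'] at hx
    induction hx using Submodule.span_induction with
    | zero => exact ⟨0, zero_mem _, by simp⟩
    | add x x' _ _ hx hx' =>
      obtain ⟨y, hy, h⟩ := hx
      obtain ⟨y', hy', h'⟩ := hx'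
      refine ⟨y + y', add_mem hy hy', ?_⟩
      convert add_mem h h' using 1
      simp only [map_add]
      abel
    | smul r x _ hx =>
      obtain ⟨y, hy, h⟩ := hx
      refine ⟨r • y, (lowerCentralSeries F H H _).smul_mem r hy, ?_⟩
      simpa only [map_smul, smul_sub] using Submodule.smul_mem _ r h
    | mem x hx =>
      obtain ⟨u, -, v, hv, rfl⟩ := hx
      obtain ⟨y, hy⟩ := key u
      obtain ⟨z, hz, hvz⟩ := ih hv
      refine ⟨⁅y, z⁆, ?_, ?_⟩
      · rw [LieModule.lowerCentralSeries_succ]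
        exact LieSubmodule.lie_mem_lie (LieSubmodule.mem_top y) hz
      have hz' := toEnveloping_mem_augmentationIdeal_pow (p := p) hz
      have hu' : e (toEnveloping F p L u) ∈ augmentationIdeal F p H ^ 1 :=
        map_augmentationIdeal_pow_le he 1 (by
          simpa using toEnveloping_mem_augmentationIdeal (p := p) u)
      -- With `u' = e u` and `v' = e v`, `[u', v'] - [y, z] = [u' - y, z] + [u', v' - z]`; all four
      -- products have degree `n + 3`.
      have m1 := Submodule.mul_mem_mul hy hz'
      have m2 := Submodule.mul_mem_mul hz' hy
      have m3 := Submodule.mul_mem_mul hu' hvz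
      have m4 := Submodule.mul_mem_mul hvz hu'
      rw [← pow_add] at m1 m2 m3 m4
      rw [show 2 + (n + 1) = n + 1 + 2 by omega] at m1
      rw [show 1 + (n + 2) = n + 1 + 2 by omega] at m3
      convert add_mem (sub_mem m1 m2) (sub_mem m3 m4) using 1
      rw [toEnveloping_lie, toEnveloping_lie, map_sub, map_mul, map_mul]
      noncomm_ring

/-- If restricted enveloping algebras are isomorphic with their augmentations, the classes of
nilpotent restricted Lie algebras differ by at most one. -/
theorem nilpotencyLength_le_succ [LieRing.IsNilpotent L] [LieRing.IsNilpotent H]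
    {e : Enveloping F p L ≃ₐ[F] Enveloping F p H}
    (he : ∀ a, augmentation F p H (e a) = augmentation F p L a) :
    LieModule.nilpotencyLength H H ≤ LieModule.nilpotencyLength L L + 1 := by
  set n := LieModule.nilpotencyLength L L
  have hn : lowerCentralSeries F L L n = ⊥ :=
    (lowerCentralSeries_eq_bot_iff_nilpotencyLength_le F L L n).2 le_rfl
  have he' : ∀ a, augmentation F p L (e.symm.toAlgHom a) = augmentation F p H a := fun a => by
    simp [← he]
  have hmem : ∀ y ∈ lowerCentralSeries F H H n,
      toEnveloping F p H y ∈ augmentationIdeal F p H ^ (n + 2) := by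
    intro y hy
    obtain ⟨x, hx, h⟩ := exists_map_sub_toEnveloping_mem he' n hy
    rw [hn, LieSubmodule.mem_bot] at hx
    rw [hx, map_zero, sub_zero] at h
    simpa using map_augmentationIdeal_pow_le (e := e.toAlgHom) he (n + 2) h
  have hle : lowerCentralSeries F H H (n + 1) ≤ lowerCentralSeries F H H (n + 2) :=
    lowerCentralSeries_succ_le fun y hy x => lie_mem_lowerCentralSeries (hmem y hy) x
  -- Bracketing `hle` repeatedly with `H` shows that the series is constant from term `n + 1` on.
  have hstep : ∀ k, lowerCentralSeries F H H (n + 1) ≤ lowerCentralSeries F H H (n + 1 + k) := by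
    intro k
    induction k with
    | zero => rfl
    | succ k ih =>
      refine hle.trans ?_
      rw [show n + 2 = n + 1 + 1 from rfl, ← add_assoc,
        LieModule.lowerCentralSeries_succ _ _ _ (n + 1),
        LieModule.lowerCentralSeries_succ _ _ _ (n + 1 + k)]
      exact LieSubmodule.mono_lie_right _ ih
  obtain ⟨k, hk⟩ := LieModule.IsNilpotent.nilpotent F H H
  have hbot : lowerCentralSeries F H H (n + 1) = ⊥ := by
    rw [eq_bot_iff, ← hk]
    exact (hstep k).trans (LieModule.antitone_lowerCentralSeries F H H (Nat.le_add_left _ _))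
  exact (lowerCentralSeries_eq_bot_iff_nilpotencyLength_le F H H _).1 hbot

end Comparison

end RestrictedLieAlgebra

theorem mainTheorem4 {F : Type*} [Field F] (p : ℕ) [Fact p.Prime] [CharP F p]
    (L : Type*) [LieRing L] [LieAlgebra F L] [RestrictedLieAlgebra F p L]
    (H : Type*) [LieRing H] [LieAlgebra F H] [RestrictedLieAlgebra F p H]
    (hfin : FiniteDimensional F L)
    (hnil : RestrictedLieAlgebra.IsPNilpotent F p L)
    (e : Nonempty (RestrictedLieAlgebra.Enveloping F p L ≃ₐ[F]
      RestrictedLieAlgebra.Enveloping F p H)) :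
    LieRing.IsNilpotent L ∧ LieRing.IsNilpotent H ∧
      |(LieModule.nilpotencyLength L L : ℤ) - (LieModule.nilpotencyLength H H : ℤ)| ≤ 1 := by
  obtain ⟨e⟩ := e
  obtain ⟨n, hn⟩ := RestrictedLieAlgebra.exists_augmentationIdeal_pow_eq_bot hnil
  have he := RestrictedLieAlgebra.augmentation_comp_of_augmentationIdeal_pow_eq_bot e.toAlgHom hn
  have he' : ∀ a, RestrictedLieAlgebra.augmentation F p L (e.symm a) =
      RestrictedLieAlgebra.augmentation F p H a := fun a => by
    simpa using (he (e.symm a)).symm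
  have hL : LieRing.IsNilpotent L :=
    RestrictedLieAlgebra.isNilpotent_of_augmentationIdeal_pow_eq_bot hn
  have hH : LieRing.IsNilpotent H := by
    refine RestrictedLieAlgebra.isNilpotent_of_augmentationIdeal_pow_eq_bot (F := F) (p := p)
      (n := n) ((Submodule.eq_bot_iff _).2 fun a ha => ?_)
    have h := RestrictedLieAlgebra.map_augmentationIdeal_pow_le (e := e.symm.toAlgHom) he' n ha
    rw [hn, Submodule.mem_bot] at h
    exact (map_eq_zero_iff e.symm e.symm.injective).1 h
  have h1 := RestrictedLieAlgebra.nilpotencyLength_le_succ (e := e) he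
  have h2 := RestrictedLieAlgebra.nilpotencyLength_le_succ (e := e.symm) he'
  refine ⟨hL, hH, abs_le.2 ⟨?_, ?_⟩⟩ <;> omega
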